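/- Let $\mathfrak g=\mathfrak g_0\oplus\mathfrak g_1$ be a finite-dimensional real $\mathbb Z_2$-graded semisimple Lie algebra, and let $\tau_{\mathfrak u}$ be a Cartan involution of $\mathfrak g$ that preserves the gradation, $\tau_{\mathfrak u}(\mathfrak g_i)=\mathfrak g_{-i}=\mathfrak g_i$ for $i\in\mathbb Z_2$ (an R-compatible Cartan involution), with Cartan decomposition $\mathfrak g=\mathfrak k\oplus\mathfrak p$, where $\mathfrak k$ is the fixed point set of $\tau_{\mathfrak u}$. Let $G$ be a connected Lie group with Lie algebra $\mathfrak g$, let $G_0$ be the connected Lie subgroup of $G$ with Lie algebra $\mathfrak g_0$, and let $K_0$ be the connected Lie subgroup of $G_0$ with Lie algebra $\mathfrak k\cap\mathfrak g_0$. Let $\mathfrak h_{st}\subset\mathfrak g_1$ be a standard Cartan subspace, i.e. a maximal subspace of $\mathfrak g_1$ consisting of commuting semisimple elements, with $\tau_{\mathfrak u}(\mathfrak h_{st})=\mathfrak h_{st}$. If $h,h'\in\mathfrak h_{st}$ are $Ad_{G_0}$-conjugate, then they are $Ad_{K_0}$-conjugate. -/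

import Mathlib

noncomputable section

namespace GradedLie

/-! ### The exponential of an endomorphism -/

section Exp

variable {V : Type*} [AddCommGroup V] [Module ℝ V]

/-- The exponential `∑ Tⁿ / n!` of an endomorphism of a finite-dimensional real vector space,
computed in the coordinates of a basis; it does not depend on the basis, see `expEnd_eq`. -/
def expEnd [FiniteDimensional ℝ V] (T : Module.End ℝ V) : Module.End ℝ V :=
  (LinearMap.toMatrixAlgEquiv (Module.finBasis ℝ V)).symm
    (NormedSpace.exp (LinearMap.toMatrixAlgEquiv (Module.finBasis ℝ V) T))

/-- The exponential may be computed in the coordinates of any basis. -/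
theorem expEnd_eq [FiniteDimensional ℝ V] {ι : Type*} [Fintype ι] [DecidableEq ι]
    (b : Module.Basis ι ℝ V) (T : Module.End ℝ V) :
    expEnd T = (LinearMap.toMatrixAlgEquiv b).symm
      (NormedSpace.exp (LinearMap.toMatrixAlgEquiv b T)) := by
  let f := (LinearMap.toMatrixAlgEquiv (Module.finBasis ℝ V)).symm.trans
    (LinearMap.toMatrixAlgEquiv b)
  have hf : Continuous f := LinearMap.continuous_of_finiteDimensional f.toLinearMap
  have key : ∀ A, f (NormedSpace.exp A) = NormedSpace.exp (f A) := by
    intro A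
    open scoped Matrix.Norms.Operator in exact NormedSpace.map_exp f hf A
  apply (LinearMap.toMatrixAlgEquiv b).injective
  have h := key (LinearMap.toMatrixAlgEquiv (Module.finBasis ℝ V) T)
  simp only [f, AlgEquiv.trans_apply, AlgEquiv.symm_apply_apply] at h
  rw [AlgEquiv.apply_symm_apply]
  exact h

/-- Every exponential is invertible, hence is an element of `GL(V)`. -/
theorem isUnit_expEnd [FiniteDimensional ℝ V] (T : Module.End ℝ V) : IsUnit (expEnd T) :=
  (Matrix.isUnit_exp _).map (LinearMap.toMatrixAlgEquiv (Module.finBasis ℝ V)).symm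

end Exp

section Lie

variable {𝔤 : Type*} [LieRing 𝔤] [LieAlgebra ℝ 𝔤]

/-- The image `Ad_S ⊆ GL(𝔤)` of the connected Lie subgroup `S` with Lie algebra `𝔰`, for a Lie
subalgebra `𝔰` of `𝔤`, under the adjoint representation on `𝔤`. A connected Lie group is generated
by the exponentials of its Lie algebra, and `Ad (exp x) = exp (ad x)`, so that `Ad_S` is the
subgroup of `GL(𝔤)` generated by all `exp (ad x)` with `x ∈ 𝔰`. -/
def adGroup [FiniteDimensional ℝ 𝔤] (𝔰 : LieSubalgebra ℝ 𝔤) :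
    Subgroup (LinearMap.GeneralLinearGroup ℝ 𝔤) :=
  Subgroup.closure
    {g | ∃ x ∈ 𝔰, (g : Module.End ℝ 𝔤) = expEnd (LieAlgebra.ad ℝ 𝔤 x)}

/-- Two elements of `𝔤` are `Ad_S`-conjugate, where `S` is the connected Lie subgroup with Lie
algebra `𝔰`. -/
def AdConj [FiniteDimensional ℝ 𝔤] (𝔰 : LieSubalgebra ℝ 𝔤) (x y : 𝔤) : Prop :=
  ∃ g ∈ adGroup 𝔰, (g : Module.End ℝ 𝔤) x = y

/-- The subalgebra `𝔤₀` of elements of degree zero in a `ℤ/m`-graded Lie algebra. -/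
def zeroPart {m : ℕ} (𝒢 : ZMod m → Submodule ℝ 𝔤) [GradedLieAlgebra 𝒢] : LieSubalgebra ℝ 𝔤 where
  toSubmodule := 𝒢 0
  lie_mem' {x y} hx hy := by
    have h : ⁅x, y⁆ ∈ 𝒢 (0 + 0) := SetLike.GradedBracket.bracket_mem hx hy
    rw [add_zero] at h
    exact h

/-- A Cartan involution: an involutive automorphism `τ` for which `-B(x, τ y)` is positive
definite, where `B` is the Killing form. -/
structure IsCartanInvolution (τ : 𝔤 ≃ₗ⁅ℝ⁆ 𝔤) : Prop where
  involutive : Function.Involutive τ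
  posDef : ∀ x : 𝔤, x ≠ 0 → 0 < -(killingForm ℝ 𝔤 x (τ x))

/-- `τ` is R-compatible with the gradation if it reverses it: `τ(𝔤 i) = 𝔤 (-i)`. -/
def IsRCompatible {m : ℕ} (𝒢 : ZMod m → Submodule ℝ 𝔤) (τ : 𝔤 ≃ₗ⁅ℝ⁆ 𝔤) : Prop :=
  ∀ i : ZMod m, (𝒢 i).map (τ : 𝔤 →ₗ[ℝ] 𝔤) = 𝒢 (-i)

/-- The subalgebra `𝔨` of fixed points of `τ`. If `τ` is a Cartan involution, it is the
`𝔨` of the Cartan decomposition `𝔤 = 𝔨 ⊕ 𝔭`. -/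
def fixedPart (τ : 𝔤 ≃ₗ⁅ℝ⁆ 𝔤) : LieSubalgebra ℝ 𝔤 where
  carrier := {x | τ x = x}
  add_mem' {x y} hx hy := by
    change τ (x + y) = x + y
    change τ x = x at hx
    change τ y = y at hy
    rw [map_add, hx, hy]
  zero_mem' := map_zero τ
  smul_mem' c x hx := by
    change τ (c • x) = c • x
    change τ x = x at hx
    rw [map_smul, hx]
  lie_mem' {x y} hx hy := by
    change τ ⁅x, y⁆ = ⁅x, y⁆
    change τ x = x at hx
    change τ y = y at hy
    rw [LieEquiv.map_lie, hx, hy]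

/-- An element is semisimple if its adjoint endomorphism is semisimple. -/
def IsSemisimpleElement (x : 𝔤) : Prop :=
  (LieAlgebra.ad ℝ 𝔤 x).IsSemisimple

/-- A Cartan subspace in `𝔤₁`: a maximal subspace of `𝔤₁` that consists of commuting semisimple
elements. -/
def IsCartanSubspace {m : ℕ} (𝒢 : ZMod m → Submodule ℝ 𝔤) (𝔥 : Submodule ℝ 𝔤) : Prop :=
  Maximal (fun 𝔞 : Submodule ℝ 𝔤 => 𝔞 ≤ 𝒢 1 ∧ (∀ x ∈ 𝔞, IsSemisimpleElement x) ∧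
    ∀ x ∈ 𝔞, ∀ y ∈ 𝔞, ⁅x, y⁆ = 0) 𝔥

/-- A standard Cartan subspace: a Cartan subspace in `𝔤₁` invariant under `τ`. -/
def IsStandardCartanSubspace {m : ℕ} (𝒢 : ZMod m → Submodule ℝ 𝔤) (τ : 𝔤 ≃ₗ⁅ℝ⁆ 𝔤)
    (𝔥 : Submodule ℝ 𝔤) : Prop :=
  IsCartanSubspace 𝒢 𝔥 ∧ ∀ x ∈ 𝔥, τ x ∈ 𝔥

end Lie

end GradedLie

end

/-! The form `-B(x, τ y)` is an inner product on `𝔤` for which the adjoint of `ad x` is `-ad (τ x)`.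
Thus `ad p` is symmetric for `p ∈ 𝔭`, and the maps in `Ad_{K₀}` are orthogonal.

Let `g h = h'` with `g ∈ Ad_{G₀}`, and write `g = k exp (ad p)` with `k ∈ Ad_{K₀}` and `p ∈ 𝔭 ∩ 𝔤₀`.
Put `w = exp (ad p) h = k⁻¹ h'`. A commutative `τ`-stable subspace contains `h` and `h'`, so each
commutes with its image under `τ`; so does `w`, because `k` commutes with `τ`. The function `‖exp (t
ad p) h‖²` is convex, and its derivative at a point `y` of the orbit is a multiple of `B(p, [y, τ
y])`. It therefore has critical points at `t = 0` and `t = 1`, which forces `[p, h] = 0` and `w = h`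
(`mulVec_eq_zero_of_exp`, `expAd_apply_eq_self`). Hence `k h = h'`.

The main work is the decomposition with `k` in the connected group. The Gram matrix of `g` is an
automorphism, its symmetric logarithm is a derivation, and derivations are inner; this gives `p`
(`exists_polar`). The orthogonal factor varies continuously as `g` is built up from exponentials,
and an orthogonal automorphism near `1` that commutes with the grading involution `θ` is `exp (ad
x)` with `x ∈ 𝔨 ∩ 𝔤₀`. Membership in `Ad_{K₀}` is thus open and closed along the path
(`mem_adGroup_of_continuous`, `orthFactor_mem_adGroup`). -/

namespace GradedLie

open scoped Matrix Topology

/-! ### Exponentials of real symmetric matrices -/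

section SymmetricMatrix

variable {n : Type*} [Fintype n] [DecidableEq n]

theorem exp_pi {ι : Type*} [Finite ι] (d : ι → ℝ) :
    NormedSpace.exp d = fun i => Real.exp (d i) := by
  ext i
  rw [Pi.coe_exp, Real.exp_eq_exp_ℝ]

/-- Orthogonal diagonalisation of a real symmetric matrix, together with its exponential. -/
theorem exists_diagonalization {D : Matrix n n ℝ} (hD : Dᵀ = D) :
    ∃ (U : Matrix n n ℝ) (d : n → ℝ), Uᵀ * U = 1 ∧ U * Uᵀ = 1 ∧
      D = U * Matrix.diagonal d * Uᵀ ∧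
      NormedSpace.exp D = U * Matrix.diagonal (fun i => Real.exp (d i)) * Uᵀ := by
  have hD' : D.IsHermitian := by
    rw [Matrix.IsHermitian, Matrix.conjTranspose_eq_transpose_of_trivial, hD]
  have h1 : (hD'.eigenvectorUnitary : Matrix n n ℝ)ᵀ * hD'.eigenvectorUnitary = 1 :=
    Unitary.coe_star_mul_self hD'.eigenvectorUnitary
  have h2 : (hD'.eigenvectorUnitary : Matrix n n ℝ) * (hD'.eigenvectorUnitary : Matrix n n ℝ)ᵀ
      = 1 := Unitary.coe_mul_star_self hD'.eigenvectorUnitary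
  have h3 : D = (hD'.eigenvectorUnitary : Matrix n n ℝ) * Matrix.diagonal hD'.eigenvalues *
      (hD'.eigenvectorUnitary : Matrix n n ℝ)ᵀ := by
    have h := hD'.spectral_theorem
    rw [Unitary.conjStarAlgAut_apply] at h
    exact h
  refine ⟨hD'.eigenvectorUnitary, hD'.eigenvalues, h1, h2, h3, ?_⟩
  generalize (hD'.eigenvectorUnitary : Matrix n n ℝ) = U at h1 h2 h3
  generalize hD'.eigenvalues = d at h3
  have hinv : Uᵀ = U⁻¹ := (Matrix.inv_eq_right_inv h2).symm
  have hU : IsUnit U := (Matrix.isUnit_iff_isUnit_det U).2 (Matrix.isUnit_det_of_right_inverse h2)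
  rw [h3, hinv, Matrix.exp_conj _ _ hU, Matrix.exp_diagonal, exp_pi]

/-- A vector whose orbit under the exponential of a symmetric matrix meets two critical points of
the norm is fixed. -/
theorem mulVec_eq_zero_of_exp {D : Matrix n n ℝ} (hD : Dᵀ = D) {v : n → ℝ}
    (h : (NormedSpace.exp D *ᵥ v) ⬝ᵥ (D *ᵥ (NormedSpace.exp D *ᵥ v)) = v ⬝ᵥ (D *ᵥ v)) :
    D *ᵥ v = 0 ∧ NormedSpace.exp D *ᵥ v = v := by
  obtain ⟨U, d, h1, h2, h3, h4⟩ := exists_diagonalization hD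
  have hv : U *ᵥ (Uᵀ *ᵥ v) = v := by rw [Matrix.mulVec_mulVec, h2, Matrix.one_mulVec]
  generalize Uᵀ *ᵥ v = c at hv
  subst hv
  have hUU : ∀ x, Uᵀ *ᵥ (U *ᵥ x) = x := fun x => by
    rw [Matrix.mulVec_mulVec, h1, Matrix.one_mulVec]
  have hdot : ∀ x y, (U *ᵥ x) ⬝ᵥ (U *ᵥ y) = x ⬝ᵥ y := fun x y => by
    rw [Matrix.dotProduct_mulVec, ← Matrix.mulVec_transpose, hUU]
  have hDx : ∀ x, D *ᵥ (U *ᵥ x) = U *ᵥ (fun i => d i * x i) := fun x => by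
    rw [h3, ← Matrix.mulVec_mulVec, hUU, ← Matrix.mulVec_mulVec]
    congr 1; ext i; rw [Matrix.mulVec_diagonal]
  have hEx : ∀ x, NormedSpace.exp D *ᵥ (U *ᵥ x) = U *ᵥ (fun i => Real.exp (d i) * x i) :=
    fun x => by
      rw [h4, ← Matrix.mulVec_mulVec, hUU, ← Matrix.mulVec_mulVec]
      congr 1; ext i; rw [Matrix.mulVec_diagonal]
  -- With `f t = ‖exp (t D) v‖²`, the hypothesis says `f' 1 = f' 0`. In eigencoordinates the
  -- difference is a sum of terms `d (e^{2d} - 1) c²`, all nonnegative, so each one vanishes.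
  rw [hEx, hDx, hDx, hdot, hdot, dotProduct, dotProduct, ← sub_eq_zero,
    ← Finset.sum_sub_distrib] at h
  have hterm : ∀ i, Real.exp (d i) * c i * (d i * (Real.exp (d i) * c i)) - c i * (d i * c i)
      = (d i * (Real.exp (2 * d i) - 1)) * c i ^ 2 := fun i => by
    rw [two_mul, Real.exp_add]; ring
  have hnn : ∀ x : ℝ, 0 ≤ x * (Real.exp (2 * x) - 1) := fun x => by
    rcases le_total 0 x with hx | hx
    · exact mul_nonneg hx (sub_nonneg.2 (Real.one_le_exp (by linarith)))
    · exact mul_nonneg_of_nonpos_of_nonpos hx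
        (sub_nonpos.2 (Real.exp_le_one_iff.2 (by linarith)))
  rw [Finset.sum_congr rfl fun i _ => hterm i,
    Finset.sum_eq_zero_iff_of_nonneg fun i _ => mul_nonneg (hnn _) (sq_nonneg _)] at h
  have hz : ∀ i, d i = 0 ∨ c i = 0 := fun i => by
    rcases mul_eq_zero.1 (h i (Finset.mem_univ i)) with h | h
    · rcases mul_eq_zero.1 h with h | h
      · exact Or.inl h
      · left
        have : Real.exp (2 * d i) = 1 := by linarith
        rw [Real.exp_eq_one_iff] at this
        linarith
    · exact Or.inr (pow_eq_zero_iff two_ne_zero |>.1 h)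
  constructor
  · rw [hDx]
    have : (fun i => d i * c i) = 0 := by
      ext i; rcases hz i with h | h <;> simp [h]
    rw [this, Matrix.mulVec_zero]
  · rw [hEx]
    congr 1
    ext i; rcases hz i with h | h <;> simp [h]

/-- An eigenvector of the exponential of a symmetric matrix is an eigenvector of the matrix. -/
theorem mulVec_eq_smul_of_exp {D : Matrix n n ℝ} (hD : Dᵀ = D) {v : n → ℝ} {c : ℝ}
    (h : NormedSpace.exp D *ᵥ v = Real.exp c • v) : D *ᵥ v = c • v := by
  -- The shift by `c` turns the eigenvector into a fixed vector of `exp D'`, to which the previous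
  -- lemma applies.
  set D' := D - c • (1 : Matrix n n ℝ) with hD'
  have hexp : NormedSpace.exp D' = Real.exp (-c) • NormedSpace.exp D := by
    have hcomm : Commute D (-(c • (1 : Matrix n n ℝ))) :=
      ((Commute.one_right D).smul_right c).neg_right
    have h1 : -(c • (1 : Matrix n n ℝ)) = Matrix.diagonal (fun _ => -c) := by
      rw [Matrix.smul_one_eq_diagonal, Matrix.diagonal_neg]
    rw [hD', sub_eq_add_neg, Matrix.exp_add_of_commute _ _ hcomm, h1, Matrix.exp_diagonal]
    rw [exp_pi, ← Matrix.smul_one_eq_diagonal, mul_smul_comm, mul_one]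
  have hv : NormedSpace.exp D' *ᵥ v = v := by
    rw [hexp, Matrix.smul_mulVec, h, smul_smul, ← Real.exp_add, neg_add_cancel, Real.exp_zero,
      one_smul]
  have ht : D'ᵀ = D' := by
    rw [hD', Matrix.transpose_sub, hD, Matrix.transpose_smul, Matrix.transpose_one]
  have h0 := (mulVec_eq_zero_of_exp ht (v := v) (by rw [hv])).1
  rw [hD', Matrix.sub_mulVec, Matrix.smul_mulVec, Matrix.one_mulVec, sub_eq_zero] at h0
  exact h0

end SymmetricMatrix

/-! ### Automorphisms and derivations of a bilinear product -/

section Bilinear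

variable {n : Type*} [Fintype n]

/-- The matrix `A` is an endomorphism of the algebra with product `μ`. -/
def PreservesProduct (μ : (n → ℝ) →ₗ[ℝ] (n → ℝ) →ₗ[ℝ] (n → ℝ)) (A : Matrix n n ℝ) : Prop :=
  ∀ x y, A *ᵥ μ x y = μ (A *ᵥ x) (A *ᵥ y)

/-- The matrix `L` is a derivation of the algebra with product `μ`. -/
def IsProductDerivation (μ : (n → ℝ) →ₗ[ℝ] (n → ℝ) →ₗ[ℝ] (n → ℝ)) (L : Matrix n n ℝ) : Prop :=
  ∀ x y, L *ᵥ μ x y = μ (L *ᵥ x) y + μ x (L *ᵥ y)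

/-- The defect of `L` from being a derivation of `μ`. -/
def derivationDefect (μ : (n → ℝ) →ₗ[ℝ] (n → ℝ) →ₗ[ℝ] (n → ℝ)) (L : Matrix n n ℝ) :
    (n → ℝ) →ₗ[ℝ] (n → ℝ) →ₗ[ℝ] (n → ℝ) :=
  μ.compr₂ L.mulVecLin - μ.compl₁₂ L.mulVecLin LinearMap.id
    - μ.compl₁₂ LinearMap.id L.mulVecLin

theorem derivationDefect_apply (μ : (n → ℝ) →ₗ[ℝ] (n → ℝ) →ₗ[ℝ] (n → ℝ)) (L : Matrix n n ℝ)
    (x y : n → ℝ) :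
    derivationDefect μ L x y = L *ᵥ μ x y - μ (L *ᵥ x) y - μ x (L *ᵥ y) := by
  simp [derivationDefect]

theorem isProductDerivation_iff {μ : (n → ℝ) →ₗ[ℝ] (n → ℝ) →ₗ[ℝ] (n → ℝ)} {L : Matrix n n ℝ} :
    IsProductDerivation μ L ↔ derivationDefect μ L = 0 := by
  constructor
  · intro h
    refine LinearMap.ext₂ fun x y => ?_
    rw [derivationDefect_apply, h x y]
    simp
  · intro h x y
    have := derivationDefect_apply μ L x y
    rw [h, sub_sub, LinearMap.zero_apply, LinearMap.zero_apply] at this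
    exact sub_eq_zero.1 this.symm

variable [DecidableEq n]

/-- A symmetric matrix whose exponential preserves a product is a derivation. -/
theorem PreservesProduct.isProductDerivation_of_symm
    {μ : (n → ℝ) →ₗ[ℝ] (n → ℝ) →ₗ[ℝ] (n → ℝ)} {D : Matrix n n ℝ} (hD : Dᵀ = D)
    (h : PreservesProduct μ (NormedSpace.exp D)) : IsProductDerivation μ D := by
  obtain ⟨U, d, h1, h2, h3, h4⟩ := exists_diagonalization hD
  have hUe : ∀ i, Uᵀ *ᵥ (U *ᵥ Pi.single i 1) = Pi.single i 1 := fun i => by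
    rw [Matrix.mulVec_mulVec, h1, Matrix.one_mulVec]
  have hDu : ∀ i, D *ᵥ (U *ᵥ Pi.single i 1) = d i • (U *ᵥ Pi.single i 1) := fun i => by
    rw [h3, ← Matrix.mulVec_mulVec, hUe, ← Matrix.mulVec_mulVec, Matrix.diagonal_mulVec_single,
      mul_one, ← Matrix.mulVec_smul]
    congr 1
    rw [← Pi.single_smul, smul_eq_mul, mul_one]
  have hEu : ∀ i, NormedSpace.exp D *ᵥ (U *ᵥ Pi.single i 1)
      = Real.exp (d i) • (U *ᵥ Pi.single i 1) := fun i => by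
    rw [h4, ← Matrix.mulVec_mulVec, hUe, ← Matrix.mulVec_mulVec, Matrix.diagonal_mulVec_single,
      mul_one, ← Matrix.mulVec_smul]
    congr 1
    rw [← Pi.single_smul, smul_eq_mul, mul_one]
  have key : ∀ i j, derivationDefect μ D (U *ᵥ Pi.single i 1) (U *ᵥ Pi.single j 1) = 0 := by
    intro i j
    -- Multiplicativity adds the exponents of eigenvectors, so `D` acts on their product by `d i + d
    -- j`, which is the Leibniz rule on an eigenbasis.
    have he : NormedSpace.exp D *ᵥ μ (U *ᵥ Pi.single i 1) (U *ᵥ Pi.single j 1)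
        = Real.exp (d i + d j) • μ (U *ᵥ Pi.single i 1) (U *ᵥ Pi.single j 1) := by
      rw [h, hEu, hEu, map_smul, map_smul, LinearMap.smul_apply, smul_smul, Real.exp_add,
        mul_comm]
    rw [derivationDefect_apply, mulVec_eq_smul_of_exp hD he, hDu, hDu, map_smul, map_smul,
      LinearMap.smul_apply, add_smul]
    abel
  rw [isProductDerivation_iff]
  have hz : (derivationDefect μ D).compl₁₂ U.mulVecLin U.mulVecLin = 0 := by
    refine LinearMap.ext_basis (Pi.basisFun ℝ n) (Pi.basisFun ℝ n) fun i j => ?_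
    simpa using key i j
  refine LinearMap.ext₂ fun x y => ?_
  have hx : U *ᵥ (Uᵀ *ᵥ x) = x := by rw [Matrix.mulVec_mulVec, h2, Matrix.one_mulVec]
  have hy : U *ᵥ (Uᵀ *ᵥ y) = y := by rw [Matrix.mulVec_mulVec, h2, Matrix.one_mulVec]
  have := LinearMap.congr_fun₂ hz (Uᵀ *ᵥ x) (Uᵀ *ᵥ y)
  simpa only [LinearMap.compl₁₂_apply, Matrix.mulVecLin_apply, hx, hy,
    LinearMap.zero_apply] using this

section Flow

open scoped Matrix.Norms.Operator

/-- Differentiation of the product transported along the flow of `L`. -/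
theorem hasDerivAt_transport (μ : (n → ℝ) →ₗ[ℝ] (n → ℝ) →ₗ[ℝ] (n → ℝ)) (L : Matrix n n ℝ)
    (x y : n → ℝ) (s : ℝ) :
    HasDerivAt (fun s : ℝ => NormedSpace.exp (s • L) *ᵥ
        μ (NormedSpace.exp (s • -L) *ᵥ x) (NormedSpace.exp (s • -L) *ᵥ y))
      (NormedSpace.exp (s • L) *ᵥ derivationDefect μ L
        (NormedSpace.exp (s • -L) *ᵥ x) (NormedSpace.exp (s • -L) *ᵥ y)) s := by
  let β : Matrix n n ℝ →L[ℝ] (n → ℝ) →L[ℝ] (n → ℝ) :=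
    LinearMap.toContinuousBilinearMap (Matrix.mulVecBilin ℝ ℝ)
  let μ' : (n → ℝ) →L[ℝ] (n → ℝ) →L[ℝ] (n → ℝ) := LinearMap.toContinuousBilinearMap μ
  have e1 := hasDerivAt_exp_smul_const (𝕂 := ℝ) L s
  have e2 := hasDerivAt_exp_smul_const' (𝕂 := ℝ) (-L) s
  have hx : ∀ z, HasDerivAt (fun s : ℝ => NormedSpace.exp (s • -L) *ᵥ z)
      ((-L * NormedSpace.exp (s • -L)) *ᵥ z) s := fun z =>
    ((β.flip z).hasFDerivAt.comp_hasDerivAt s e2)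
  have hm := μ'.hasDerivAt_of_bilinear (fun _ => hx x) (fun _ => hx y)
  have hf := β.hasDerivAt_of_bilinear (fun _ => e1) (fun _ => hm)
  refine HasDerivAt.congr_deriv hf ?_
  change NormedSpace.exp (s • L) *ᵥ (μ (NormedSpace.exp (s • -L) *ᵥ x)
      ((-L * NormedSpace.exp (s • -L)) *ᵥ y) + μ ((-L * NormedSpace.exp (s • -L)) *ᵥ x)
      (NormedSpace.exp (s • -L) *ᵥ y)) + (NormedSpace.exp (s • L) * L) *ᵥ
      μ (NormedSpace.exp (s • -L) *ᵥ x) (NormedSpace.exp (s • -L) *ᵥ y) = _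
  simp only [derivationDefect_apply, ← Matrix.mulVec_mulVec, Matrix.neg_mulVec, map_neg,
    LinearMap.neg_apply, Matrix.mulVec_sub, Matrix.mulVec_add, Matrix.mulVec_neg]
  abel

/-- The exponential of a derivation preserves the product. -/
theorem IsProductDerivation.preservesProduct_exp
    {μ : (n → ℝ) →ₗ[ℝ] (n → ℝ) →ₗ[ℝ] (n → ℝ)} {L : Matrix n n ℝ}
    (h : IsProductDerivation μ L) : PreservesProduct μ (NormedSpace.exp L) := by
  rw [isProductDerivation_iff] at h
  have hc : ∀ x y, NormedSpace.exp L *ᵥ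
      μ (NormedSpace.exp (-L) *ᵥ x) (NormedSpace.exp (-L) *ᵥ y) = μ x y := by
    intro x y
    have hd := hasDerivAt_transport μ L x y
    simp only [h, LinearMap.zero_apply, Matrix.mulVec_zero] at hd
    have := is_const_of_deriv_eq_zero (fun s => (hd s).differentiableAt)
      (fun s => (hd s).deriv) 1 0
    simpa using this
  have hinv : ∀ v, NormedSpace.exp (-L) *ᵥ (NormedSpace.exp L *ᵥ v) = v := fun v => by
    rw [Matrix.mulVec_mulVec, ← Matrix.exp_add_of_commute _ _ (Commute.neg_left (Commute.refl L)),
      neg_add_cancel, NormedSpace.exp_zero, Matrix.one_mulVec]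
  intro x y
  have := hc (NormedSpace.exp L *ᵥ x) (NormedSpace.exp L *ᵥ y)
  rwa [hinv, hinv] at this

/-- A sufficiently small matrix whose exponential preserves a product is a derivation. -/
theorem eventually_isProductDerivation (μ : (n → ℝ) →ₗ[ℝ] (n → ℝ) →ₗ[ℝ] (n → ℝ)) :
    ∀ᶠ L in 𝓝 (0 : Matrix n n ℝ), PreservesProduct μ (NormedSpace.exp L) →
      IsProductDerivation μ L := by
  -- With `1/8` the three error terms below add up to `(81 + 72 + 64)/512 < 1/2` times `‖B‖ ‖x‖
  -- ‖y‖`.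
  have hexp : ∀ᶠ A in 𝓝 (0 : Matrix n n ℝ), ‖NormedSpace.exp A - 1‖ < 1 / 8 := by
    have hcont : Continuous fun A : Matrix n n ℝ => ‖NormedSpace.exp A - 1‖ :=
      (NormedSpace.exp_continuous.sub continuous_const).norm
    have := hcont.tendsto 0
    rw [NormedSpace.exp_zero, sub_self, norm_zero] at this
    exact this.eventually (gt_mem_nhds (by norm_num))
  obtain ⟨r, hr, hball⟩ := Metric.eventually_nhds_iff_ball.1 hexp
  filter_upwards [Metric.ball_mem_nhds (0 : Matrix n n ℝ) hr] with L hL hμ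
  rw [mem_ball_zero_iff] at hL
  have hsmall : ∀ s ∈ Set.Icc (0 : ℝ) 1, ‖NormedSpace.exp (s • L) - 1‖ ≤ 1 / 8 ∧
      ‖NormedSpace.exp (s • -L) - 1‖ ≤ 1 / 8 := by
    intro s hs
    have hs' : ‖s • L‖ < r := by
      rw [norm_smul, Real.norm_of_nonneg hs.1]
      exact lt_of_le_of_lt (mul_le_of_le_one_left (norm_nonneg _) hs.2) hL
    exact ⟨(hball _ (mem_ball_zero_iff.2 hs')).le,
      (hball _ (mem_ball_zero_iff.2 (by rwa [smul_neg, norm_neg]))).le⟩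
  let B : (n → ℝ) →L[ℝ] (n → ℝ) →L[ℝ] (n → ℝ) :=
    LinearMap.toContinuousBilinearMap (derivationDefect μ L)
  have hB : ∀ u v, derivationDefect μ L u v = B u v := fun _ _ => rfl
  have hmv : ∀ (A : Matrix n n ℝ) (v : n → ℝ), ‖A - 1‖ ≤ 1 / 8 → ‖A *ᵥ v - v‖ ≤ 1 / 8 * ‖v‖ := by
    intro A v hA
    have : A *ᵥ v - v = (A - 1) *ᵥ v := by rw [Matrix.sub_mulVec, Matrix.one_mulVec]
    rw [this]
    exact (Matrix.linfty_opNorm_mulVec _ _).trans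
      (mul_le_mul_of_nonneg_right hA (norm_nonneg _))
  have hmv' : ∀ (A : Matrix n n ℝ) (v : n → ℝ), ‖A - 1‖ ≤ 1 / 8 → ‖A *ᵥ v‖ ≤ 9 / 8 * ‖v‖ := by
    intro A v hA
    have := norm_add_le (A *ᵥ v - v) v
    rw [sub_add_cancel] at this
    linarith [hmv A v hA]
  -- The transported product agrees at times `0` and `1`, while its derivative stays close to the
  -- defect `B`. The mean value inequality, after subtracting `s • B x y`, bounds `B` by half its
  -- own norm, so `B = 0`.
  have hbound : ∀ x y : n → ℝ, ‖B x y‖ ≤ 1 / 2 * ‖B‖ * ‖x‖ * ‖y‖ := by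
    intro x y
    have hder : ∀ s ∈ Set.Icc (0 : ℝ) 1, HasDerivWithinAt
        (fun s : ℝ => NormedSpace.exp (s • L) *ᵥ
          μ (NormedSpace.exp (s • -L) *ᵥ x) (NormedSpace.exp (s • -L) *ᵥ y) - s • B x y)
        (NormedSpace.exp (s • L) *ᵥ derivationDefect μ L
          (NormedSpace.exp (s • -L) *ᵥ x) (NormedSpace.exp (s • -L) *ᵥ y) - B x y)
        (Set.Icc 0 1) s := by
      intro s _
      have h1 : HasDerivAt (fun s : ℝ => s • B x y) (B x y) s := by
        simpa using (hasDerivAt_id s).smul_const (B x y)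
      exact ((hasDerivAt_transport μ L x y s).sub h1).hasDerivWithinAt
    have hnorm : ∀ s ∈ Set.Ico (0 : ℝ) 1, ‖NormedSpace.exp (s • L) *ᵥ derivationDefect μ L
          (NormedSpace.exp (s • -L) *ᵥ x) (NormedSpace.exp (s • -L) *ᵥ y) - B x y‖
          ≤ 1 / 2 * ‖B‖ * ‖x‖ * ‖y‖ := by
      intro s hs
      obtain ⟨hp, hq⟩ := hsmall s ⟨hs.1, hs.2.le⟩
      generalize NormedSpace.exp (s • L) = p at hp
      generalize NormedSpace.exp (s • -L) = q at hq
      rw [hB]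
      have hsplit : p *ᵥ B (q *ᵥ x) (q *ᵥ y) - B x y
          = (p *ᵥ B (q *ᵥ x) (q *ᵥ y) - B (q *ᵥ x) (q *ᵥ y)) + B (q *ᵥ x - x) (q *ᵥ y)
            + B x (q *ᵥ y - y) := by
        simp only [map_sub, sub_apply]
        abel
      have b0 : ‖B (q *ᵥ x) (q *ᵥ y)‖ ≤ ‖B‖ * (9 / 8 * ‖x‖) * (9 / 8 * ‖y‖) :=
        (B.le_opNorm₂ _ _).trans (by gcongr <;> exact hmv' _ _ hq)
      have b1 := hmv p (B (q *ᵥ x) (q *ᵥ y)) hp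
      have b2 : ‖B (q *ᵥ x - x) (q *ᵥ y)‖ ≤ ‖B‖ * (1 / 8 * ‖x‖) * (9 / 8 * ‖y‖) :=
        (B.le_opNorm₂ _ _).trans (by
          gcongr
          · exact hmv _ _ hq
          · exact hmv' _ _ hq)
      have b3 : ‖B x (q *ᵥ y - y)‖ ≤ ‖B‖ * ‖x‖ * (1 / 8 * ‖y‖) :=
        (B.le_opNorm₂ _ _).trans (by gcongr; exact hmv _ _ hq)
      have hP : 0 ≤ ‖B‖ * ‖x‖ * ‖y‖ := by positivity
      rw [hsplit]
      refine (norm_add₃_le).trans ?_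
      nlinarith
    have hmvt := norm_image_sub_le_of_norm_deriv_le_segment' hder hnorm 1
      (Set.right_mem_Icc.2 zero_le_one)
    have hend : NormedSpace.exp L *ᵥ
        μ (NormedSpace.exp (-L) *ᵥ x) (NormedSpace.exp (-L) *ᵥ y) = μ x y := by
      have hinv : ∀ v, NormedSpace.exp L *ᵥ (NormedSpace.exp (-L) *ᵥ v) = v := fun v => by
        rw [Matrix.mulVec_mulVec,
          ← Matrix.exp_add_of_commute _ _ (Commute.neg_right (Commute.refl L)),
          add_neg_cancel, NormedSpace.exp_zero, Matrix.one_mulVec]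
      rw [hμ, hinv, hinv]
    simpa [hend] using hmvt
  have hle : ‖B‖ ≤ 1 / 2 * ‖B‖ := B.opNorm_le_bound₂ (by positivity) hbound
  have hB0 : ‖B‖ = 0 := by
    have := norm_nonneg B
    linarith
  rw [isProductDerivation_iff]
  refine LinearMap.ext₂ fun x y => ?_
  have := hbound x y
  rw [hB0, mul_zero, zero_mul, zero_mul, norm_le_zero_iff] at this
  exact this

end Flow

end Bilinear

end GradedLie

namespace GradedLie

open scoped Matrix Topology

/-! ### Matrix logarithms and the orthogonal polar factor -/

section OrthogonalFactor

variable {n : Type*} [Fintype n]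

section LocalInverse

variable [DecidableEq n]

open scoped Matrix.Norms.Operator

/-- The exponential of matrices is locally surjective at the origin. -/
theorem eventually_exists_exp_eq {P : Matrix n n ℝ → Prop} (hP : ∀ᶠ L in 𝓝 0, P L) :
    ∀ᶠ A in 𝓝 (1 : Matrix n n ℝ), ∃ L, P L ∧ NormedSpace.exp L = A := by
  have h : HasStrictFDerivAt (NormedSpace.exp : Matrix n n ℝ → Matrix n n ℝ)
      ((ContinuousLinearEquiv.refl ℝ (Matrix n n ℝ) : Matrix n n ℝ ≃L[ℝ] Matrix n n ℝ) :
        Matrix n n ℝ →L[ℝ] Matrix n n ℝ) 0 := hasStrictFDerivAt_exp_zero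
  have hmap : Filter.map NormedSpace.exp (𝓝 (0 : Matrix n n ℝ)) = 𝓝 1 := by
    have := h.map_nhds_eq_of_equiv
    rw [NormedSpace.exp_zero] at this
    exact this
  rw [← hmap, Filter.eventually_map]
  filter_upwards [hP] with L hL using ⟨L, hL, rfl⟩

/-- The exponential of matrices is locally injective at the origin. -/
theorem exists_nhds_injOn_exp :
    ∃ S ∈ 𝓝 (0 : Matrix n n ℝ), Set.InjOn NormedSpace.exp S := by
  have h : HasStrictFDerivAt (NormedSpace.exp : Matrix n n ℝ → Matrix n n ℝ)
      ((ContinuousLinearEquiv.refl ℝ (Matrix n n ℝ) : Matrix n n ℝ ≃L[ℝ] Matrix n n ℝ) :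
        Matrix n n ℝ →L[ℝ] Matrix n n ℝ) 0 := hasStrictFDerivAt_exp_zero
  exact ⟨_, (h.toOpenPartialHomeomorph _).open_source.mem_nhds
    h.mem_toOpenPartialHomeomorph_source, (h.toOpenPartialHomeomorph _).injOn⟩

end LocalInverse

open scoped Matrix.Norms.L2Operator MatrixOrder

theorem transpose_mul_self_nonneg (A : Matrix n n ℝ) : 0 ≤ Aᵀ * A := by
  rw [Matrix.nonneg_iff_posSemidef, ← Matrix.conjTranspose_eq_transpose_of_trivial]
  exact Matrix.posSemidef_conjTranspose_mul_self A

variable [DecidableEq n]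

/-- The orthogonal factor of an invertible matrix in its polar decomposition. -/
noncomputable def orthFactor (A : Matrix n n ℝ) : Matrix n n ℝ :=
  A * (CFC.sqrt (Aᵀ * A))⁻¹

theorem exp_symm_nonneg {D : Matrix n n ℝ} (hD : Dᵀ = D) : 0 ≤ NormedSpace.exp D := by
  obtain ⟨U, d, -, -, -, h⟩ := exists_diagonalization hD
  have : NormedSpace.exp D =
      (Matrix.diagonal (fun i => Real.sqrt (Real.exp (d i))) * Uᵀ)ᵀ *
        (Matrix.diagonal (fun i => Real.sqrt (Real.exp (d i))) * Uᵀ) := by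
    rw [h, Matrix.transpose_mul, Matrix.transpose_transpose, Matrix.diagonal_transpose,
      mul_assoc, mul_assoc, ← mul_assoc (Matrix.diagonal _) (Matrix.diagonal _),
      Matrix.diagonal_mul_diagonal]
    simp only [Real.mul_self_sqrt (Real.exp_pos _).le]
  rw [this]
  exact transpose_mul_self_nonneg _

theorem isUnit_transpose_mul_self {A : Matrix n n ℝ} (hA : IsUnit A) : IsUnit (Aᵀ * A) :=
  ((Matrix.isUnit_transpose A).2 hA).mul hA

/-- The Gram matrix of an invertible matrix is the exponential of a symmetric matrix. -/
theorem exists_symm_exp_eq {A : Matrix n n ℝ} (hA : IsUnit A) :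
    ∃ D : Matrix n n ℝ, Dᵀ = D ∧ NormedSpace.exp D = Aᵀ * A := by
  have hpos : IsStrictlyPositive (Aᵀ * A) :=
    ⟨transpose_mul_self_nonneg A, isUnit_transpose_mul_self hA⟩
  refine ⟨CFC.log (Aᵀ * A), ?_, CFC.exp_log (Aᵀ * A) hpos⟩
  have h : IsSelfAdjoint (CFC.log (Aᵀ * A)) := IsSelfAdjoint.log
  rw [← Matrix.conjTranspose_eq_transpose_of_trivial]
  exact h

/-- The exponential is injective on symmetric matrices. -/
theorem exp_injective_of_symm {D E : Matrix n n ℝ} (hD : Dᵀ = D) (hE : Eᵀ = E)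
    (h : NormedSpace.exp D = NormedSpace.exp E) : D = E := by
  have h1 : IsSelfAdjoint D := by
    rw [IsSelfAdjoint, Matrix.star_eq_conjTranspose,
      Matrix.conjTranspose_eq_transpose_of_trivial, hD]
  have h2 : IsSelfAdjoint E := by
    rw [IsSelfAdjoint, Matrix.star_eq_conjTranspose,
      Matrix.conjTranspose_eq_transpose_of_trivial, hE]
  rw [← CFC.log_exp D h1, ← CFC.log_exp E h2, h]

/-- The Gram matrix is `(exp D)²`, whose unique nonnegative square root is `exp D`. Every polar
decomposition therefore has the same orthogonal factor. -/
theorem orthFactor_mul_exp {k D : Matrix n n ℝ} (hk : kᵀ * k = 1) (hD : Dᵀ = D) :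
    orthFactor (k * NormedSpace.exp D) = k := by
  have hexp : (NormedSpace.exp D)ᵀ = NormedSpace.exp D := by rw [← Matrix.exp_transpose, hD]
  have hgram : NormedSpace.exp D * NormedSpace.exp D
      = (k * NormedSpace.exp D)ᵀ * (k * NormedSpace.exp D) := by
    rw [Matrix.transpose_mul, hexp, mul_assoc, ← mul_assoc kᵀ, hk, one_mul]
  have hu : IsUnit (NormedSpace.exp D).det :=
    (Matrix.isUnit_iff_isUnit_det _).1 (Matrix.isUnit_exp D)
  rw [orthFactor, CFC.sqrt_unique hgram (exp_symm_nonneg hD), mul_assoc,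
    Matrix.mul_nonsing_inv _ hu, mul_one]

/-- The square root is continuous on nonnegative matrices, and the root of an invertible Gram matrix
is invertible. The closed formula supplies the continuity that a mere existence statement for the
factor lacks. -/
theorem continuous_orthFactor {γ : ℝ → Matrix n n ℝ} (hγ : Continuous γ)
    (hu : ∀ t, IsUnit (γ t)) : Continuous fun t => orthFactor (γ t) := by
  have hgram : Continuous fun t => (γ t)ᵀ * γ t := hγ.matrix_transpose.mul hγ
  have hsqrt : Continuous fun t => CFC.sqrt ((γ t)ᵀ * γ t) :=
    CFC.continuousOn_sqrt.comp_continuous hgram fun t => transpose_mul_self_nonneg (γ t)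
  have hdet : ∀ t, (CFC.sqrt ((γ t)ᵀ * γ t)).det ≠ 0 := fun t =>
    ((Matrix.isUnit_iff_isUnit_det _).1 ((CFC.isUnit_sqrt_iff _
      (transpose_mul_self_nonneg (γ t))).2 (isUnit_transpose_mul_self (hu t)))).ne_zero
  refine hγ.mul (continuous_iff_continuousAt.2 fun t => ?_)
  have hinv : ContinuousAt Ring.inverse (CFC.sqrt ((γ t)ᵀ * γ t)).det := by
    rw [Ring.inverse_eq_inv']
    exact continuousAt_inv₀ (hdet t)
  exact ContinuousAt.comp (f := fun t => CFC.sqrt ((γ t)ᵀ * γ t))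
    (continuousAt_matrix_inv _ hinv) hsqrt.continuousAt

end OrthogonalFactor

end GradedLie

namespace GradedLie

open scoped Matrix Topology

/-! ### The inner product of a Cartan involution -/

section CartanForm

/-- A positive definite symmetric bilinear form has an orthonormal basis. -/
theorem exists_basis_dotProduct {V : Type*} [AddCommGroup V] [Module ℝ V]
    [FiniteDimensional ℝ V] (Q : V →ₗ[ℝ] V →ₗ[ℝ] ℝ) (hsymm : ∀ x y, Q x y = Q y x)
    (hpos : ∀ x, x ≠ 0 → 0 < Q x x) :
    ∃ b : Module.Basis (Fin (Module.finrank ℝ V)) ℝ V,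
      ∀ x y, Q x y = b.equivFun x ⬝ᵥ b.equivFun y := by
  obtain ⟨v, hv⟩ := LinearMap.BilinForm.exists_orthogonal_basis (B := Q)
    ⟨fun x y => by simpa using hsymm x y⟩
  have hvpos : ∀ i, 0 < Q (v i) (v i) := fun i => hpos _ (v.ne_zero i)
  have hunit : ∀ i, IsUnit (Real.sqrt (Q (v i) (v i)))⁻¹ := fun i =>
    IsUnit.mk0 _ (inv_ne_zero (Real.sqrt_ne_zero'.2 (hvpos i)))
  refine ⟨v.isUnitSMul hunit, ?_⟩
  set b := v.isUnitSMul hunit with hb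
  have hbb : ∀ i j, Q (b i) (b j) = if i = j then 1 else 0 := by
    intro i j
    rw [hb, Module.Basis.isUnitSMul_apply, Module.Basis.isUnitSMul_apply, map_smul, map_smul,
      LinearMap.smul_apply, smul_eq_mul, smul_eq_mul]
    split_ifs with hij
    · subst hij
      have h1 := Real.mul_self_sqrt (hvpos i).le
      have h2 : Real.sqrt (Q (v i) (v i)) ≠ 0 := Real.sqrt_ne_zero'.2 (hvpos i)
      field_simp
      linarith
    · have : Q (v i) (v j) = 0 := LinearMap.isOrthoᵢ_def.1 hv i j hij
      rw [this, mul_zero, mul_zero]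
  intro x y
  conv_lhs => rw [← b.sum_equivFun x, ← b.sum_equivFun y]
  simp only [map_sum, LinearMap.sum_apply, map_smul, LinearMap.smul_apply, hbb, smul_eq_mul,
    dotProduct, mul_ite, mul_one, mul_zero, Finset.sum_ite_eq',
    Finset.mem_univ, if_true]
  exact Finset.sum_congr rfl fun i _ => mul_comm _ _

variable {𝔤 : Type*} [LieRing 𝔤] [LieAlgebra ℝ 𝔤]

/-- The form `-B(x, τ y)`. -/
noncomputable def cartanForm (τ : 𝔤 ≃ₗ⁅ℝ⁆ 𝔤) : 𝔤 →ₗ[ℝ] 𝔤 →ₗ[ℝ] ℝ :=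
  -((killingForm ℝ 𝔤).compl₂ (τ : 𝔤 →ₗ[ℝ] 𝔤))

theorem cartanForm_apply (τ : 𝔤 ≃ₗ⁅ℝ⁆ 𝔤) (x y : 𝔤) :
    cartanForm τ x y = -killingForm ℝ 𝔤 x (τ y) := rfl

theorem cartanForm_symm {τ : 𝔤 ≃ₗ⁅ℝ⁆ 𝔤} (hτ : IsCartanInvolution τ) (x y : 𝔤) :
    cartanForm τ x y = cartanForm τ y x := by
  rw [cartanForm_apply, cartanForm_apply, ← LieAlgebra.killingForm_of_equiv_apply τ, hτ.involutive,
    LieModule.traceForm_comm]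

theorem cartanForm_lie {τ : 𝔤 ≃ₗ⁅ℝ⁆ 𝔤} (hτ : IsCartanInvolution τ) (x y z : 𝔤) :
    cartanForm τ ⁅x, y⁆ z = -cartanForm τ y ⁅τ x, z⁆ := by
  rw [cartanForm_apply, cartanForm_apply, LieEquiv.map_lie, hτ.involutive, ← lie_skew x y, map_neg,
    LinearMap.neg_apply, LieModule.traceForm_apply_lie_apply]

/-- An element with zero adjoint is in the kernel of the Killing form, which positive definiteness
makes trivial. -/
theorem eq_of_ad_eq {τ : 𝔤 ≃ₗ⁅ℝ⁆ 𝔤} (hτ : IsCartanInvolution τ) {x y : 𝔤}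
    (h : LieAlgebra.ad ℝ 𝔤 x = LieAlgebra.ad ℝ 𝔤 y) : x = y := by
  by_contra hne
  have hpos := hτ.posDef (x - y) (sub_ne_zero.2 hne)
  rw [killingForm_apply_apply, map_sub, h, sub_self] at hpos
  simp at hpos

end CartanForm

/-! ### The involution of a `ℤ/2`-gradation -/

section Grading

variable {𝔤 : Type*} [LieRing 𝔤] [LieAlgebra ℝ 𝔤]

/-- A `ℤ/2`-gradation is the eigenspace decomposition of an involutive automorphism, which commutes
with every R-compatible automorphism. -/
theorem exists_grading_involution (𝒢 : ZMod 2 → Submodule ℝ 𝔤) [GradedLieAlgebra 𝒢] :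
    ∃ θ : 𝔤 ≃ₗ⁅ℝ⁆ 𝔤, Function.Involutive θ ∧ (∀ x, x ∈ 𝒢 0 ↔ θ x = x) ∧
      ∀ τ : 𝔤 ≃ₗ⁅ℝ⁆ 𝔤, IsRCompatible 𝒢 τ → ∀ x, τ (θ x) = θ (τ x) := by
  have hc : IsCompl (𝒢 0) (𝒢 1) :=
    (DirectSum.Decomposition.isInternal 𝒢).isCompl (by decide) (by
      rw [eq_comm, Set.eq_univ_iff_forall]
      decide)
  have hsum : ∀ x : 𝔤, ∃ y ∈ 𝒢 0, ∃ z ∈ 𝒢 1, y + z = x := fun x =>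
    Submodule.mem_sup.1 (hc.sup_eq_top ▸ Submodule.mem_top)
  let f : 𝔤 →ₗ[ℝ] 𝔤 := LinearMap.ofIsCompl hc (𝒢 0).subtype (-(𝒢 1).subtype)
  have f0 : ∀ x ∈ 𝒢 0, f x = x := fun x hx =>
    LinearMap.ofIsCompl_apply_left hc (φ := (𝒢 0).subtype) (⟨x, hx⟩ : 𝒢 0)
  have f1 : ∀ x ∈ 𝒢 1, f x = -x := fun x hx =>
    LinearMap.ofIsCompl_apply_right hc (φ := (𝒢 0).subtype) (⟨x, hx⟩ : 𝒢 1)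
  have hf : Function.Involutive f := fun x => by
    obtain ⟨y, hy, z, hz, rfl⟩ := hsum x
    rw [map_add, f0 y hy, f1 z hz, map_add, f0 y hy, map_neg, f1 z hz, neg_neg]
  have hlie : ∀ x y, f ⁅x, y⁆ = ⁅f x, f y⁆ := by
    have h00 : ∀ x ∈ 𝒢 0, ∀ y ∈ 𝒢 0, f ⁅x, y⁆ = ⁅x, y⁆ := fun x hx y hy =>
      f0 _ (SetLike.GradedBracket.bracket_mem (i := (0 : ZMod 2)) (j := 0) hx hy)
    have h01 : ∀ x ∈ 𝒢 0, ∀ y ∈ 𝒢 1, f ⁅x, y⁆ = -⁅x, y⁆ := fun x hx y hy =>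
      f1 _ (SetLike.GradedBracket.bracket_mem (i := (0 : ZMod 2)) (j := 1) hx hy)
    have h10 : ∀ x ∈ 𝒢 1, ∀ y ∈ 𝒢 0, f ⁅x, y⁆ = -⁅x, y⁆ := fun x hx y hy =>
      f1 _ (SetLike.GradedBracket.bracket_mem (i := (1 : ZMod 2)) (j := 0) hx hy)
    have h11 : ∀ x ∈ 𝒢 1, ∀ y ∈ 𝒢 1, f ⁅x, y⁆ = ⁅x, y⁆ := fun x hx y hy =>
      f0 _ (SetLike.GradedBracket.bracket_mem (i := (1 : ZMod 2)) (j := 1) hx hy)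
    intro x y
    obtain ⟨x0, hx0, x1, hx1, rfl⟩ := hsum x
    obtain ⟨y0, hy0, y1, hy1, rfl⟩ := hsum y
    simp only [lie_add, add_lie, map_add, f0 _ hx0, f0 _ hy0, f1 _ hx1, f1 _ hy1,
      h00 _ hx0 _ hy0, h01 _ hx0 _ hy1, h10 _ hx1 _ hy0, h11 _ hx1 _ hy1, lie_neg, neg_lie]
    abel
  let θ : 𝔤 ≃ₗ⁅ℝ⁆ 𝔤 :=
    { f with
      map_lie' := fun {x y} => hlie x y
      invFun := f
      left_inv := hf
      right_inv := hf }
  refine ⟨θ, hf, fun x => ⟨f0 x, fun hx => ?_⟩, fun τ hτ x => ?_⟩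
  · obtain ⟨y, hy, z, hz, rfl⟩ := hsum x
    have h : f (y + z) = y + z := hx
    rw [map_add, f0 y hy, f1 z hz, add_right_inj, neg_eq_iff_add_eq_zero, ← two_smul ℝ,
      smul_eq_zero_iff_right two_ne_zero] at h
    rw [h, add_zero]
    exact hy
  · have hmem : ∀ i, ∀ y ∈ 𝒢 i, τ y ∈ 𝒢 i := fun i y hy => by
      have h := hτ i
      rw [ZMod.neg_eq_self_mod_two] at h
      rw [← h]
      exact Submodule.mem_map_of_mem hy
    change τ (f x) = f (τ x)
    obtain ⟨y, hy, z, hz, rfl⟩ := hsum x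
    rw [map_add, f0 y hy, f1 z hz, map_add, map_neg, map_add, map_add, f0 _ (hmem 0 y hy),
      f1 _ (hmem 1 z hz)]

end Grading

/-! ### Brackets, exponentials and adjoints in coordinates -/

section Coordinates

variable {𝔤 : Type*} [LieRing 𝔤] [LieAlgebra ℝ 𝔤] {ι : Type*} [Fintype ι] [DecidableEq ι]
  (b : Module.Basis ι ℝ 𝔤)

theorem toMatrix_mulVec (T : Module.End ℝ 𝔤) (x : 𝔤) :
    LinearMap.toMatrixAlgEquiv b T *ᵥ b.equivFun x = b.equivFun (T x) :=
  LinearMap.toMatrix_mulVec_repr b b T x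

theorem toMatrix_expEnd [FiniteDimensional ℝ 𝔤] (T : Module.End ℝ 𝔤) :
    LinearMap.toMatrixAlgEquiv b (expEnd T) =
      NormedSpace.exp (LinearMap.toMatrixAlgEquiv b T) := by
  rw [expEnd_eq b, AlgEquiv.apply_symm_apply]

/-- The Lie bracket in coordinates. -/
noncomputable def bracketProduct : (ι → ℝ) →ₗ[ℝ] (ι → ℝ) →ₗ[ℝ] (ι → ℝ) :=
  ((LieModule.toEnd ℝ 𝔤 𝔤 : 𝔤 →ₗ[ℝ] Module.End ℝ 𝔤).compl₁₂
    (b.equivFun.symm : (ι → ℝ) →ₗ[ℝ] 𝔤) (b.equivFun.symm : (ι → ℝ) →ₗ[ℝ] 𝔤)).compr₂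
    (b.equivFun : 𝔤 →ₗ[ℝ] (ι → ℝ))

omit [DecidableEq ι] in
theorem bracketProduct_equivFun (x y : 𝔤) :
    bracketProduct b (b.equivFun x) (b.equivFun y) = b.equivFun ⁅x, y⁆ := by
  simp [bracketProduct]

theorem preservesProduct_toMatrix_iff (T : Module.End ℝ 𝔤) :
    PreservesProduct (bracketProduct b) (LinearMap.toMatrixAlgEquiv b T) ↔
      ∀ x y, T ⁅x, y⁆ = ⁅T x, T y⁆ := by
  simp only [PreservesProduct, b.equivFun.surjective.forall, bracketProduct_equivFun,
    toMatrix_mulVec, b.equivFun.injective.eq_iff]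

theorem isProductDerivation_toMatrix_iff (T : Module.End ℝ 𝔤) :
    IsProductDerivation (bracketProduct b) (LinearMap.toMatrixAlgEquiv b T) ↔
      ∀ x y, T ⁅x, y⁆ = ⁅T x, y⁆ + ⁅x, T y⁆ := by
  simp only [IsProductDerivation, b.equivFun.surjective.forall, bracketProduct_equivFun,
    toMatrix_mulVec, ← map_add, b.equivFun.injective.eq_iff]

theorem isProductDerivation_ad (x : 𝔤) :
    IsProductDerivation (bracketProduct b)
      (LinearMap.toMatrixAlgEquiv b (LieAlgebra.ad ℝ 𝔤 x)) := by
  rw [isProductDerivation_toMatrix_iff]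
  intro y z
  simp only [LieAlgebra.ad_apply]
  exact leibniz_lie x y z

/-- Derivations of a semisimple Lie algebra are inner. -/
theorem exists_eq_toMatrix_ad [FiniteDimensional ℝ 𝔤] [LieAlgebra.IsSemisimple ℝ 𝔤]
    {D : Matrix ι ι ℝ} (hD : IsProductDerivation (bracketProduct b) D) :
    ∃ x, D = LinearMap.toMatrixAlgEquiv b (LieAlgebra.ad ℝ 𝔤 x) := by
  obtain ⟨T, rfl⟩ := (LinearMap.toMatrixAlgEquiv b).surjective D
  rw [isProductDerivation_toMatrix_iff] at hD
  let d : LieDerivation ℝ 𝔤 𝔤 :=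
    { T with
      leibniz' := fun x y => by
        change T ⁅x, y⁆ = ⁅x, T y⁆ - ⁅y, T x⁆
        rw [hD, ← lie_skew y (T x)]
        abel }
  obtain ⟨x, hx⟩ := LieDerivation.IsKilling.exists_eq_ad d
  refine ⟨x, congrArg _ (LinearMap.ext fun y => ?_)⟩
  have := LieDerivation.congr_fun hx y
  rw [LieDerivation.ad_apply_apply] at this
  exact this.symm

/-- The exponential of an inner derivation is an automorphism. -/
theorem expEnd_ad_lie [FiniteDimensional ℝ 𝔤] (x y z : 𝔤) :
    expEnd (LieAlgebra.ad ℝ 𝔤 x) ⁅y, z⁆ =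
      ⁅expEnd (LieAlgebra.ad ℝ 𝔤 x) y, expEnd (LieAlgebra.ad ℝ 𝔤 x) z⁆ := by
  refine (preservesProduct_toMatrix_iff (Module.finBasis ℝ 𝔤) _).1 ?_ y z
  rw [toMatrix_expEnd]
  exact (isProductDerivation_ad _ x).preservesProduct_exp

theorem exp_conj_involution {Θ : Matrix ι ι ℝ} (hΘ : Θ * Θ = 1) (D : Matrix ι ι ℝ) :
    NormedSpace.exp (Θ * D * Θ) = Θ * NormedSpace.exp D * Θ := by
  have hinv : Θ⁻¹ = Θ := Matrix.inv_eq_right_inv hΘ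
  have h := Matrix.exp_conj Θ D
    ((Matrix.isUnit_iff_isUnit_det _).2 (Matrix.isUnit_det_of_right_inverse hΘ))
  rwa [hinv] at h

theorem toMatrix_involution {φ : 𝔤 ≃ₗ⁅ℝ⁆ 𝔤} (hφ : Function.Involutive φ) :
    LinearMap.toMatrixAlgEquiv b (φ : 𝔤 →ₗ[ℝ] 𝔤) * LinearMap.toMatrixAlgEquiv b (φ : 𝔤 →ₗ[ℝ] 𝔤)
      = 1 := by
  rw [← map_mul, ← map_one (LinearMap.toMatrixAlgEquiv b)]
  exact congrArg _ (LinearMap.ext fun x => hφ x)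

theorem toMatrix_conj_ad {φ : 𝔤 ≃ₗ⁅ℝ⁆ 𝔤} (hφ : Function.Involutive φ) (x : 𝔤) :
    LinearMap.toMatrixAlgEquiv b (φ : 𝔤 →ₗ[ℝ] 𝔤) *
      LinearMap.toMatrixAlgEquiv b (LieAlgebra.ad ℝ 𝔤 x) *
      LinearMap.toMatrixAlgEquiv b (φ : 𝔤 →ₗ[ℝ] 𝔤) =
    LinearMap.toMatrixAlgEquiv b (LieAlgebra.ad ℝ 𝔤 (φ x)) := by
  rw [← map_mul, ← map_mul]
  refine congrArg _ (LinearMap.ext fun y => ?_)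
  change φ ⁅x, φ y⁆ = ⁅φ x, y⁆
  rw [LieEquiv.map_lie, hφ]

/-- An involution intertwines the exponentials of `ad x` and of the image. -/
theorem involution_expEnd_ad [FiniteDimensional ℝ 𝔤] {φ : 𝔤 ≃ₗ⁅ℝ⁆ 𝔤}
    (hφ : Function.Involutive φ) (x y : 𝔤) :
    φ (expEnd (LieAlgebra.ad ℝ 𝔤 x) y) = expEnd (LieAlgebra.ad ℝ 𝔤 (φ x)) (φ y) := by
  have h : (φ : 𝔤 →ₗ[ℝ] 𝔤) * expEnd (LieAlgebra.ad ℝ 𝔤 x) * (φ : 𝔤 →ₗ[ℝ] 𝔤) =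
      expEnd (LieAlgebra.ad ℝ 𝔤 (φ x)) := by
    apply (LinearMap.toMatrixAlgEquiv (Module.finBasis ℝ 𝔤)).injective
    rw [map_mul, map_mul, toMatrix_expEnd, toMatrix_expEnd,
      ← exp_conj_involution (toMatrix_involution _ hφ), toMatrix_conj_ad _ hφ]
  rw [← h]
  change _ = φ (expEnd (LieAlgebra.ad ℝ 𝔤 x) (φ (φ y)))
  rw [hφ]

variable {b} {τ : 𝔤 ≃ₗ⁅ℝ⁆ 𝔤}

/-- In an orthonormal basis the transpose is the adjoint. -/
theorem toMatrix_transpose (hb : ∀ x y, cartanForm τ x y = b.equivFun x ⬝ᵥ b.equivFun y)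
    {S T : Module.End ℝ 𝔤} (h : ∀ x y, cartanForm τ (T x) y = cartanForm τ x (S y)) :
    (LinearMap.toMatrixAlgEquiv b T)ᵀ = LinearMap.toMatrixAlgEquiv b S := by
  ext i j
  have h1 := h (b i) (b j)
  rw [hb, hb] at h1
  simpa [LinearMap.toMatrixAlgEquiv_apply, Finsupp.single_eq_pi_single] using h1

/-- This makes `ad x` symmetric on `𝔭` and skew-symmetric on `𝔨`; with faithfulness of `ad`, the
converse holds too. -/
theorem toMatrix_ad_transpose (hτ : IsCartanInvolution τ)
    (hb : ∀ x y, cartanForm τ x y = b.equivFun x ⬝ᵥ b.equivFun y) (x : 𝔤) :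
    (LinearMap.toMatrixAlgEquiv b (LieAlgebra.ad ℝ 𝔤 x))ᵀ =
      -LinearMap.toMatrixAlgEquiv b (LieAlgebra.ad ℝ 𝔤 (τ x)) := by
  rw [← map_neg]
  refine toMatrix_transpose hb fun y z => ?_
  rw [LieAlgebra.ad_apply, cartanForm_lie hτ, LinearMap.neg_apply, LieAlgebra.ad_apply, map_neg]

/-- An involutive automorphism commuting with `τ` is symmetric. -/
theorem toMatrix_involution_transpose
    (hb : ∀ x y, cartanForm τ x y = b.equivFun x ⬝ᵥ b.equivFun y) {φ : 𝔤 ≃ₗ⁅ℝ⁆ 𝔤}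
    (hφ : Function.Involutive φ) (hcomm : ∀ x, τ (φ x) = φ (τ x)) :
    (LinearMap.toMatrixAlgEquiv b (φ : 𝔤 →ₗ[ℝ] 𝔤))ᵀ =
      LinearMap.toMatrixAlgEquiv b (φ : 𝔤 →ₗ[ℝ] 𝔤) := by
  refine toMatrix_transpose hb fun x y => ?_
  change cartanForm τ (φ x) y = cartanForm τ x (φ y)
  rw [cartanForm_apply, cartanForm_apply, ← LieAlgebra.killingForm_of_equiv_apply φ, hφ, hcomm]

end Coordinates

end GradedLie

namespace GradedLie

open scoped Matrix Topology

/-! ### Polar decomposition in the centralizer of the grading involution -/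

section Polar

variable {𝔤 : Type*} [LieRing 𝔤] [LieAlgebra ℝ 𝔤]

/-- The group of Lie algebra automorphisms that commute with `θ`. -/
def commutingAutGroup (θ : 𝔤 ≃ₗ⁅ℝ⁆ 𝔤) : Subgroup (LinearMap.GeneralLinearGroup ℝ 𝔤) where
  carrier := {g | (∀ x y, (g : Module.End ℝ 𝔤) ⁅x, y⁆ =
      ⁅(g : Module.End ℝ 𝔤) x, (g : Module.End ℝ 𝔤) y⁆) ∧
    ∀ x, (g : Module.End ℝ 𝔤) (θ x) = θ ((g : Module.End ℝ 𝔤) x)}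
  mul_mem' {g h} hg hh := by
    refine ⟨fun x y => ?_, fun x => ?_⟩
    · rw [Units.val_mul, Module.End.mul_apply, hh.1, hg.1]
      rfl
    · rw [Units.val_mul, Module.End.mul_apply, hh.2, hg.2]
      rfl
  one_mem' := ⟨fun _ _ => rfl, fun _ => rfl⟩
  inv_mem' {g} hg := by
    have h1 : ∀ x, (g : Module.End ℝ 𝔤)
        (((g⁻¹ : LinearMap.GeneralLinearGroup ℝ 𝔤) : Module.End ℝ 𝔤) x) = x :=
      fun x => LinearMap.congr_fun g.mul_inv x
    have h2 : ∀ x, ((g⁻¹ : LinearMap.GeneralLinearGroup ℝ 𝔤) : Module.End ℝ 𝔤)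
        ((g : Module.End ℝ 𝔤) x) = x := fun x => LinearMap.congr_fun g.inv_mul x
    refine ⟨fun x y => ?_, fun x => ?_⟩
    · conv_lhs => rw [← h1 x, ← h1 y, ← hg.1, h2]
    · conv_lhs => rw [← h1 x, ← hg.2, h2]

variable [FiniteDimensional ℝ 𝔤]

/-- The element `exp (ad x)` of `GL(𝔤)`. -/
noncomputable def expAd (x : 𝔤) : LinearMap.GeneralLinearGroup ℝ 𝔤 :=
  (isUnit_expEnd (LieAlgebra.ad ℝ 𝔤 x)).unit

theorem val_expAd (x : 𝔤) : (expAd x : Module.End ℝ 𝔤) = expEnd (LieAlgebra.ad ℝ 𝔤 x) := rfl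

theorem expAd_mem_adGroup {𝔰 : LieSubalgebra ℝ 𝔤} {x : 𝔤} (hx : x ∈ 𝔰) : expAd x ∈ adGroup 𝔰 :=
  Subgroup.subset_closure ⟨x, hx, rfl⟩

theorem expAd_mem_commutingAutGroup {θ : 𝔤 ≃ₗ⁅ℝ⁆ 𝔤} (hθ : Function.Involutive θ) {x : 𝔤}
    (hx : θ x = x) : expAd x ∈ commutingAutGroup θ :=
  ⟨expEnd_ad_lie x, fun y => by
    rw [val_expAd]
    have := involution_expEnd_ad hθ x y
    rw [hx] at this
    exact this.symm⟩

theorem expAd_add_of_lie_eq_zero {x y : 𝔤} (h : ⁅x, y⁆ = 0) :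
    expAd (x + y) = expAd x * expAd y := by
  have hcomm : Commute (LieAlgebra.ad ℝ 𝔤 x) (LieAlgebra.ad ℝ 𝔤 y) := by
    refine LinearMap.ext fun z => ?_
    change ⁅x, ⁅y, z⁆⁆ = ⁅y, ⁅x, z⁆⁆
    rw [leibniz_lie, h, zero_lie, zero_add]
  apply Units.ext
  apply (LinearMap.toMatrixAlgEquiv (Module.finBasis ℝ 𝔤)).injective
  rw [Units.val_mul, map_mul, val_expAd, val_expAd, val_expAd, toMatrix_expEnd, toMatrix_expEnd,
    toMatrix_expEnd, map_add, map_add, Matrix.exp_add_of_commute]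
  exact hcomm.map (LinearMap.toMatrixAlgEquiv (Module.finBasis ℝ 𝔤))

theorem expAd_zero : expAd (0 : 𝔤) = 1 := by
  apply Units.ext
  apply (LinearMap.toMatrixAlgEquiv (Module.finBasis ℝ 𝔤)).injective
  rw [val_expAd, toMatrix_expEnd, map_zero, map_zero, NormedSpace.exp_zero, Units.val_one, map_one]

theorem expAd_neg (x : 𝔤) : expAd (-x) = (expAd x)⁻¹ := by
  rw [eq_inv_iff_mul_eq_one, ← expAd_add_of_lie_eq_zero (by rw [neg_lie, lie_self, neg_zero]),
    neg_add_cancel, expAd_zero]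

variable {ι : Type*} [Fintype ι] [DecidableEq ι] {b : Module.Basis ι ℝ 𝔤} {τ θ : 𝔤 ≃ₗ⁅ℝ⁆ 𝔤}

theorem toMatrix_expAd (b : Module.Basis ι ℝ 𝔤) (x : 𝔤) :
    LinearMap.toMatrixAlgEquiv b (expAd x : Module.End ℝ 𝔤) =
      NormedSpace.exp (LinearMap.toMatrixAlgEquiv b (LieAlgebra.ad ℝ 𝔤 x)) :=
  toMatrix_expEnd b _

omit [FiniteDimensional ℝ 𝔤] in
theorem isUnit_toMatrix (b : Module.Basis ι ℝ 𝔤) (g : LinearMap.GeneralLinearGroup ℝ 𝔤) :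
    IsUnit (LinearMap.toMatrixAlgEquiv b (g : Module.End ℝ 𝔤)) :=
  g.isUnit.map _

omit [FiniteDimensional ℝ 𝔤] in
/-- The adjoint of an automorphism `g` is `τ g⁻¹ τ`. -/
theorem toMatrix_transpose_of_mem (hτ : IsCartanInvolution τ)
    (hb : ∀ x y, cartanForm τ x y = b.equivFun x ⬝ᵥ b.equivFun y)
    {g : LinearMap.GeneralLinearGroup ℝ 𝔤} (hg : g ∈ commutingAutGroup θ) :
    (LinearMap.toMatrixAlgEquiv b (g : Module.End ℝ 𝔤))ᵀ =
      LinearMap.toMatrixAlgEquiv b ((τ : 𝔤 →ₗ[ℝ] 𝔤) *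
        (g⁻¹ : LinearMap.GeneralLinearGroup ℝ 𝔤) * (τ : 𝔤 →ₗ[ℝ] 𝔤)) := by
  let e : 𝔤 ≃ₗ⁅ℝ⁆ 𝔤 :=
    { LinearMap.GeneralLinearGroup.generalLinearEquiv ℝ 𝔤 g with
      map_lie' := fun {x y} => hg.1 x y }
  refine toMatrix_transpose hb fun x y => ?_
  change cartanForm τ (e x) y = cartanForm τ x (τ (e.symm (τ y)))
  rw [cartanForm_apply, cartanForm_apply, hτ.involutive,
    ← LieAlgebra.killingForm_of_equiv_apply e x, LieEquiv.apply_symm_apply]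

variable [LieAlgebra.IsSemisimple ℝ 𝔤]

/-- Polar decomposition of the automorphisms commuting with `θ`. -/
theorem exists_polar (hτ : IsCartanInvolution τ)
    (hb : ∀ x y, cartanForm τ x y = b.equivFun x ⬝ᵥ b.equivFun y)
    (hθ : Function.Involutive θ) (hτθ : ∀ x, τ (θ x) = θ (τ x))
    {g : LinearMap.GeneralLinearGroup ℝ 𝔤} (hg : g ∈ commutingAutGroup θ) :
    ∃ (p : 𝔤) (k : LinearMap.GeneralLinearGroup ℝ 𝔤), θ p = p ∧ τ p = -p ∧
      k ∈ commutingAutGroup θ ∧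
      (LinearMap.toMatrixAlgEquiv b (k : Module.End ℝ 𝔤))ᵀ *
        LinearMap.toMatrixAlgEquiv b (k : Module.End ℝ 𝔤) = 1 ∧
      g = k * expAd p := by
  obtain ⟨D, hD, hexp⟩ := exists_symm_exp_eq (isUnit_toMatrix b g)
  have hgi := (commutingAutGroup θ).inv_mem hg
  have hgram : NormedSpace.exp D = LinearMap.toMatrixAlgEquiv b ((τ : 𝔤 →ₗ[ℝ] 𝔤) *
        (g⁻¹ : LinearMap.GeneralLinearGroup ℝ 𝔤) * (τ : 𝔤 →ₗ[ℝ] 𝔤) * (g : Module.End ℝ 𝔤)) := by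
    rw [hexp, toMatrix_transpose_of_mem hτ hb hg, map_mul _ _ (g : Module.End ℝ 𝔤)]
  -- The Gram matrix is that of `τ g⁻¹ τ g`, a composite of automorphisms.
  have hpres : PreservesProduct (bracketProduct b) (NormedSpace.exp D) := by
    rw [hgram, preservesProduct_toMatrix_iff]
    intro x y
    simp only [Module.End.mul_apply, hg.1]
    change τ (((g⁻¹ : LinearMap.GeneralLinearGroup ℝ 𝔤) : Module.End ℝ 𝔤) (τ ⁅_, _⁆)) = _
    rw [LieEquiv.map_lie, hgi.1, LieEquiv.map_lie]
    rfl
  obtain ⟨z, hz⟩ := exists_eq_toMatrix_ad b (hpres.isProductDerivation_of_symm hD)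
  set Θ := LinearMap.toMatrixAlgEquiv b (θ : 𝔤 →ₗ[ℝ] 𝔤) with hΘ
  have hΘΘ : Θ * Θ = 1 := toMatrix_involution b hθ
  have hΘt : Θᵀ = Θ := toMatrix_involution_transpose hb hθ hτθ
  have hθz : θ z = z := by
    -- Conjugation by `θ` fixes the Gram matrix, hence also its unique symmetric logarithm.
    have h1 : Θ * D * Θ = D := by
      refine exp_injective_of_symm ?_ hD ?_
      · rw [Matrix.transpose_mul, Matrix.transpose_mul, hΘt, hD, mul_assoc]
      · rw [exp_conj_involution hΘΘ, hgram, hΘ, ← map_mul, ← map_mul]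
        refine congrArg _ (LinearMap.ext fun x => ?_)
        simp only [Module.End.mul_apply]
        change θ (τ (((g⁻¹ : LinearMap.GeneralLinearGroup ℝ 𝔤) : Module.End ℝ 𝔤)
          (τ ((g : Module.End ℝ 𝔤) (θ x))))) = _
        rw [hg.2, hτθ, hgi.2, hτθ, hθ]
        rfl
    rw [hz, toMatrix_conj_ad b hθ] at h1
    exact eq_of_ad_eq hτ ((LinearMap.toMatrixAlgEquiv b).injective h1)
  have hτz : τ z = -z := by
    have h1 := toMatrix_ad_transpose hτ hb z
    rw [← hz, hD, hz, ← map_neg, ← map_neg] at h1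
    rw [← neg_eq_iff_eq_neg]
    exact (eq_of_ad_eq hτ ((LinearMap.toMatrixAlgEquiv b).injective h1)).symm
  have hθp : θ ((1 / 2 : ℝ) • z) = (1 / 2 : ℝ) • z := by rw [map_smul, hθz]
  have hτp : τ ((1 / 2 : ℝ) • z) = -((1 / 2 : ℝ) • z) := by rw [map_smul, hτz, smul_neg]
  -- Half of `z` is taken because the square of `exp (ad p)` must be the Gram matrix `exp (ad z)`.
  have hzp : z = (1 / 2 : ℝ) • z + (1 / 2 : ℝ) • z := by rw [← add_smul]; norm_num
  generalize (1 / 2 : ℝ) • z = p at hθp hτp hzp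
  refine ⟨p, g * expAd (-p), hθp, hτp,
    (commutingAutGroup θ).mul_mem hg (expAd_mem_commutingAutGroup hθ (by rw [map_neg, hθp])), ?_,
    by rw [expAd_neg, inv_mul_cancel_right]⟩
  have hS : (LinearMap.toMatrixAlgEquiv b (expAd (-p) : Module.End ℝ 𝔤))ᵀ =
      LinearMap.toMatrixAlgEquiv b (expAd (-p) : Module.End ℝ 𝔤) := by
    rw [toMatrix_expAd, ← Matrix.exp_transpose, toMatrix_ad_transpose hτ hb, map_neg τ, hτp,
      map_neg (LieAlgebra.ad ℝ 𝔤) (-p), map_neg, neg_neg]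
  rw [Units.val_mul, map_mul, Matrix.transpose_mul, hS, mul_assoc, ← mul_assoc _ᵀ, ← hexp, hz,
    ← toMatrix_expAd, ← map_mul, ← map_mul, ← Units.val_mul, ← Units.val_mul, hzp,
    expAd_add_of_lie_eq_zero (lie_self p), expAd_neg]
  simp

/-- Near the identity, the orthogonal automorphisms commuting with `θ` are exponentials of
elements fixed by `θ` and `τ`. -/
theorem eventually_exists_eq_expAd (hτ : IsCartanInvolution τ)
    (hb : ∀ x y, cartanForm τ x y = b.equivFun x ⬝ᵥ b.equivFun y)
    (hθ : Function.Involutive θ) :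
    ∀ᶠ A in 𝓝 (1 : Matrix ι ι ℝ), ∀ k ∈ commutingAutGroup θ,
      LinearMap.toMatrixAlgEquiv b (k : Module.End ℝ 𝔤) = A → Aᵀ * A = 1 →
      ∃ x, θ x = x ∧ τ x = x ∧ k = expAd x := by
  -- The logarithm `L` is taken so small that `L`, `Θ L Θ` and `-Lᵀ` all lie in `S`. Their
  -- exponentials agree when `exp L` is orthogonal and commutes with `θ`, so the three matrices
  -- coincide.
  obtain ⟨S, hS, hinj⟩ := exists_nhds_injOn_exp (n := ι)
  set Θ := LinearMap.toMatrixAlgEquiv b (θ : 𝔤 →ₗ[ℝ] 𝔤) with hΘ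
  have hΘΘ : Θ * Θ = 1 := toMatrix_involution b hθ
  have hc1 : Continuous fun L : Matrix ι ι ℝ => Θ * L * Θ :=
    (continuous_const.mul continuous_id).mul continuous_const
  have hc2 : Continuous fun L : Matrix ι ι ℝ => -Lᵀ := continuous_id.matrix_transpose.neg
  have hS1 : ∀ᶠ L in 𝓝 (0 : Matrix ι ι ℝ), Θ * L * Θ ∈ S := by
    have h := hc1.tendsto 0
    simp only [mul_zero, zero_mul] at h
    exact h hS
  have hS2 : ∀ᶠ L in 𝓝 (0 : Matrix ι ι ℝ), -Lᵀ ∈ S := by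
    have h := hc2.tendsto 0
    simp only [Matrix.transpose_zero, neg_zero] at h
    exact h hS
  have hall := ((Filter.Eventually.and hS (hS1.and hS2)).and
    (eventually_isProductDerivation (bracketProduct b)))
  filter_upwards [eventually_exists_exp_eq hall]
  rintro A ⟨L, ⟨⟨hL, hL1, hL2⟩, hder⟩, hexp⟩ k hk rfl horth
  have hpres : PreservesProduct (bracketProduct b) (NormedSpace.exp L) := by
    rw [hexp, preservesProduct_toMatrix_iff]
    exact hk.1
  obtain ⟨x, rfl⟩ := exists_eq_toMatrix_ad b (hder hpres)
  refine ⟨x, ?_, ?_, ?_⟩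
  · have h1 := hinj hL1 hL (by
      rw [exp_conj_involution hΘΘ, hexp, hΘ, ← map_mul, ← map_mul]
      refine congrArg _ (LinearMap.ext fun y => ?_)
      change θ ((k : Module.End ℝ 𝔤) (θ y)) = (k : Module.End ℝ 𝔤) y
      rw [hk.2, hθ])
    rw [toMatrix_conj_ad b hθ] at h1
    exact eq_of_ad_eq hτ ((LinearMap.toMatrixAlgEquiv b).injective h1)
  · have h1 := hinj hL2 hL (by
      rw [Matrix.exp_neg, Matrix.exp_transpose, hexp, ← Matrix.inv_eq_left_inv horth,
        Matrix.nonsing_inv_nonsing_inv]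
      exact (Matrix.isUnit_iff_isUnit_det _).1 (isUnit_toMatrix b k))
    rw [toMatrix_ad_transpose hτ hb, neg_neg] at h1
    exact eq_of_ad_eq hτ ((LinearMap.toMatrixAlgEquiv b).injective h1)
  · apply Units.ext
    apply (LinearMap.toMatrixAlgEquiv b).injective
    rw [toMatrix_expAd, hexp]

/-- A path of orthogonal automorphisms commuting with `θ` that starts in the connected group of the
common fixed points of `θ` and `τ` stays there. -/
theorem mem_adGroup_of_continuous (hτ : IsCartanInvolution τ)
    (hb : ∀ x y, cartanForm τ x y = b.equivFun x ⬝ᵥ b.equivFun y)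
    (hθ : Function.Involutive θ) {𝔰 : LieSubalgebra ℝ 𝔤} (h𝔰 : ∀ x, x ∈ 𝔰 ↔ θ x = x)
    {k : ℝ → LinearMap.GeneralLinearGroup ℝ 𝔤} (hk : ∀ t, k t ∈ commutingAutGroup θ)
    (horth : ∀ t, (LinearMap.toMatrixAlgEquiv b (k t : Module.End ℝ 𝔤))ᵀ *
      LinearMap.toMatrixAlgEquiv b (k t : Module.End ℝ 𝔤) = 1)
    (hκ : Continuous fun t => LinearMap.toMatrixAlgEquiv b (k t : Module.End ℝ 𝔤))
    (h0 : k 0 ∈ adGroup (𝔰 ⊓ fixedPart τ)) (t : ℝ) : k t ∈ adGroup (𝔰 ⊓ fixedPart τ) := by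
  have hlocal : ∀ t, ∀ᶠ s in 𝓝 t, (k t)⁻¹ * k s ∈ adGroup (𝔰 ⊓ fixedPart τ) := by
    intro t
    have hmat : ∀ s, LinearMap.toMatrixAlgEquiv b
        (((k t)⁻¹ * k s : LinearMap.GeneralLinearGroup ℝ 𝔤) : Module.End ℝ 𝔤) =
        (LinearMap.toMatrixAlgEquiv b (k t : Module.End ℝ 𝔤))ᵀ * LinearMap.toMatrixAlgEquiv b (k s : Module.End ℝ 𝔤) := by
      intro s
      rw [Units.val_mul, map_mul]
      congr 1
      refine (left_inv_eq_right_inv (horth t) ?_).symm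
      rw [← map_mul, Units.mul_inv, map_one]
    have hcont : Continuous fun s =>
        (LinearMap.toMatrixAlgEquiv b (k t : Module.End ℝ 𝔤))ᵀ * LinearMap.toMatrixAlgEquiv b (k s : Module.End ℝ 𝔤) :=
      continuous_const.mul hκ
    have hlim := hcont.tendsto t
    simp only [horth t] at hlim
    filter_upwards [hlim.eventually (eventually_exists_eq_expAd hτ hb hθ)] with s hs
    obtain ⟨y, hy1, hy2, hy⟩ := hs _ ((commutingAutGroup θ).mul_mem
      ((commutingAutGroup θ).inv_mem (hk t)) (hk s)) (hmat s) (by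
        rw [Matrix.transpose_mul, Matrix.transpose_transpose, mul_assoc, ← mul_assoc _ _ᵀ,
          mul_eq_one_comm.1 (horth t), one_mul, horth s])
    rw [hy]
    exact expAd_mem_adGroup ⟨(h𝔰 y).2 hy1, hy2⟩
  have hiff : ∀ t, ∀ᶠ s in 𝓝 t,
      (k s ∈ adGroup (𝔰 ⊓ fixedPart τ) ↔ k t ∈ adGroup (𝔰 ⊓ fixedPart τ)) := by
    intro t
    filter_upwards [hlocal t] with s hs
    have := Subgroup.mul_mem_cancel_right (adGroup (𝔰 ⊓ fixedPart τ)) hs (y := k t)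
    rwa [mul_inv_cancel_left] at this
  -- Nearby values of `k` lie in the same coset, so membership is locally constant on the connected
  -- line.
  have hclopen : IsClopen {t | k t ∈ adGroup (𝔰 ⊓ fixedPart τ)} := by
    constructor
    · rw [← isOpen_compl_iff, isOpen_iff_mem_nhds]
      intro t ht
      filter_upwards [hiff t] with s hs using fun h => ht (hs.1 h)
    · rw [isOpen_iff_mem_nhds]
      intro t ht
      filter_upwards [hiff t] with s hs using hs.2 ht
  have huniv := hclopen.eq_univ ⟨0, h0⟩
  have : t ∈ {t | k t ∈ adGroup (𝔰 ⊓ fixedPart τ)} := huniv ▸ Set.mem_univ _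
  exact this

/-- The orthogonal factor of an element of the connected group of the fixed points of `θ` lies in
the connected group of the common fixed points of `θ` and `τ`. -/
theorem orthFactor_mem_adGroup (hτ : IsCartanInvolution τ)
    (hb : ∀ x y, cartanForm τ x y = b.equivFun x ⬝ᵥ b.equivFun y)
    (hθ : Function.Involutive θ) (hτθ : ∀ x, τ (θ x) = θ (τ x))
    {𝔰 : LieSubalgebra ℝ 𝔤} (h𝔰 : ∀ x, x ∈ 𝔰 ↔ θ x = x)
    {g : LinearMap.GeneralLinearGroup ℝ 𝔤} (hg : g ∈ adGroup 𝔰) :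
    g ∈ commutingAutGroup θ ∧ ∃ k ∈ adGroup (𝔰 ⊓ fixedPart τ),
      orthFactor (LinearMap.toMatrixAlgEquiv b (g : Module.End ℝ 𝔤)) =
        LinearMap.toMatrixAlgEquiv b (k : Module.End ℝ 𝔤) := by
  -- Multiplication by a generator is reached along the path `exp (t ad x) g`, whose orthogonal
  -- factor starts in the group at `t = 0`.
  have step : ∀ x ∈ 𝔰, ∀ g, (g ∈ commutingAutGroup θ ∧ ∃ k ∈ adGroup (𝔰 ⊓ fixedPart τ),
      orthFactor (LinearMap.toMatrixAlgEquiv b (g : Module.End ℝ 𝔤)) =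
        LinearMap.toMatrixAlgEquiv b (k : Module.End ℝ 𝔤)) →
      (expAd x * g ∈ commutingAutGroup θ ∧ ∃ k ∈ adGroup (𝔰 ⊓ fixedPart τ),
      orthFactor (LinearMap.toMatrixAlgEquiv b ((expAd x * g : LinearMap.GeneralLinearGroup ℝ 𝔤) :
        Module.End ℝ 𝔤)) = LinearMap.toMatrixAlgEquiv b (k : Module.End ℝ 𝔤)) := by
    rintro x hx g ⟨hg, hgK⟩
    have hmem : ∀ t : ℝ, expAd (t • x) * g ∈ commutingAutGroup θ := fun t =>
      (commutingAutGroup θ).mul_mem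
        (expAd_mem_commutingAutGroup hθ (by rw [map_smul, (h𝔰 x).1 hx])) hg
    let γ : ℝ → Matrix ι ι ℝ := fun t => LinearMap.toMatrixAlgEquiv b
      ((expAd (t • x) * g : LinearMap.GeneralLinearGroup ℝ 𝔤) : Module.End ℝ 𝔤)
    have hγ : Continuous γ := by
      have h : γ = fun t => NormedSpace.exp (t • LinearMap.toMatrixAlgEquiv b
          (LieAlgebra.ad ℝ 𝔤 x)) * LinearMap.toMatrixAlgEquiv b (g : Module.End ℝ 𝔤) := by
        funext t
        simp only [γ, Units.val_mul, map_mul, toMatrix_expAd, map_smul]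
      rw [h]
      have hcont : Continuous (NormedSpace.exp : Matrix ι ι ℝ → Matrix ι ι ℝ) := by
        open scoped Matrix.Norms.Operator in exact NormedSpace.exp_continuous
      exact (hcont.comp (continuous_id.smul continuous_const)).mul continuous_const
    have hκ : Continuous fun t => orthFactor (γ t) :=
      continuous_orthFactor hγ fun t => isUnit_toMatrix b _
    have hfac : ∀ t, ∃ k ∈ commutingAutGroup θ,
        (LinearMap.toMatrixAlgEquiv b (k : Module.End ℝ 𝔤))ᵀ *
          LinearMap.toMatrixAlgEquiv b (k : Module.End ℝ 𝔤) = 1 ∧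
        orthFactor (γ t) = LinearMap.toMatrixAlgEquiv b (k : Module.End ℝ 𝔤) := by
      intro t
      obtain ⟨p, k, -, hp, hk, horth, hkp⟩ := exists_polar hτ hb hθ hτθ (hmem t)
      refine ⟨k, hk, horth, ?_⟩
      have hD : (LinearMap.toMatrixAlgEquiv b (LieAlgebra.ad ℝ 𝔤 p))ᵀ =
          LinearMap.toMatrixAlgEquiv b (LieAlgebra.ad ℝ 𝔤 p) := by
        rw [toMatrix_ad_transpose hτ hb, hp, map_neg, map_neg, neg_neg]
      have hγt : γ t = LinearMap.toMatrixAlgEquiv b (k : Module.End ℝ 𝔤) *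
          NormedSpace.exp (LinearMap.toMatrixAlgEquiv b (LieAlgebra.ad ℝ 𝔤 p)) := by
        rw [← toMatrix_expAd, ← map_mul, ← Units.val_mul, ← hkp]
      rw [hγt]
      exact orthFactor_mul_exp horth hD
    -- The matrix of `k t` is forced to be the orthogonal factor of `γ t`, so the pointwise choice
    -- is continuous.
    choose k hk horth hkγ using hfac
    have h0 : k 0 ∈ adGroup (𝔰 ⊓ fixedPart τ) := by
      obtain ⟨k', hk', hgk'⟩ := hgK
      have h : k 0 = k' := by
        apply Units.ext
        apply (LinearMap.toMatrixAlgEquiv b).injective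
        rw [← hkγ, ← hgk']
        simp only [γ, zero_smul, expAd_zero, one_mul]
      rwa [h]
    have h1 : k 1 ∈ adGroup (𝔰 ⊓ fixedPart τ) := by
      refine mem_adGroup_of_continuous hτ hb hθ h𝔰 hk horth ?_ h0 1
      simpa only [hkγ] using hκ
    have hm := hmem 1
    have hk1 := hkγ 1
    simp only [γ, one_smul] at hm hk1
    exact ⟨hm, k 1, h1, hk1⟩
  refine Subgroup.closure_induction_left (p := fun g _ => g ∈ commutingAutGroup θ ∧
    ∃ k ∈ adGroup (𝔰 ⊓ fixedPart τ),
      orthFactor (LinearMap.toMatrixAlgEquiv b (g : Module.End ℝ 𝔤)) =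
        LinearMap.toMatrixAlgEquiv b (k : Module.End ℝ 𝔤)) ?_ ?_ ?_ hg
  · refine ⟨one_mem _, 1, one_mem _, ?_⟩
    have h := orthFactor_mul_exp (k := (1 : Matrix ι ι ℝ)) (D := 0) (by simp) (by simp)
    rw [NormedSpace.exp_zero, mul_one] at h
    rw [Units.val_one, map_one, h]
  · rintro u ⟨x, hx, hu⟩ g - hg
    have : u = expAd x := Units.ext hu
    rw [this]
    exact step x hx g hg
  · rintro u ⟨x, hx, hu⟩ g - hg
    have : u = expAd x := Units.ext hu
    rw [this, ← expAd_neg]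
    exact step (-x) (neg_mem hx) g hg

end Polar

/-! ### Critical points of the norm and conjugacy -/

section Conjugacy

variable {𝔤 : Type*} [LieRing 𝔤] [LieAlgebra ℝ 𝔤] [FiniteDimensional ℝ 𝔤]

/-- Commutation with `τ` lets elements of `Ad_{K₀}` carry the relation `[y, τ y] = 0` from one
vector to another. -/
theorem mem_commutingAutGroup_of_mem_adGroup {𝔰 : LieSubalgebra ℝ 𝔤} {g : LinearMap.GeneralLinearGroup ℝ 𝔤}
    {τ : 𝔤 ≃ₗ⁅ℝ⁆ 𝔤} (hτ : Function.Involutive τ) (hg : g ∈ adGroup (𝔰 ⊓ fixedPart τ)) :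
    g ∈ commutingAutGroup τ := by
  refine (Subgroup.closure_le _).2 ?_ hg
  rintro u ⟨x, hx, hu⟩
  have : u = expAd x := Units.ext hu
  rw [this]
  exact expAd_mem_commutingAutGroup hτ hx.2

/-- If `x` commutes with `τ x` and `exp (ad p) x = w` commutes with `τ w`, where `τ p = -p`, then
`w = x`. -/
theorem expAd_apply_eq_self {ι : Type*} [Fintype ι] [DecidableEq ι] {b : Module.Basis ι ℝ 𝔤}
    {τ : 𝔤 ≃ₗ⁅ℝ⁆ 𝔤} (hτ : IsCartanInvolution τ)
    (hb : ∀ x y, cartanForm τ x y = b.equivFun x ⬝ᵥ b.equivFun y) {p x : 𝔤} (hp : τ p = -p)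
    (hx : ⁅x, τ x⁆ = 0)
    (hw : ⁅(expAd p : Module.End ℝ 𝔤) x, τ ((expAd p : Module.End ℝ 𝔤) x)⁆ = 0) :
    (expAd p : Module.End ℝ 𝔤) x = x := by
  -- By invariance of the Killing form, the inner product of `y` and `[p, y]` is `-B(p, [y, τ y])`.
  have hcrit : ∀ y, ⁅y, τ y⁆ = 0 → b.equivFun y ⬝ᵥ
      (LinearMap.toMatrixAlgEquiv b (LieAlgebra.ad ℝ 𝔤 p) *ᵥ b.equivFun y) = 0 := by
    intro y hy
    rw [toMatrix_mulVec, ← hb, cartanForm_symm hτ, cartanForm_apply, LieAlgebra.ad_apply,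
      LieModule.traceForm_apply_lie_apply, hy, map_zero, neg_zero]
  have hD : (LinearMap.toMatrixAlgEquiv b (LieAlgebra.ad ℝ 𝔤 p))ᵀ =
      LinearMap.toMatrixAlgEquiv b (LieAlgebra.ad ℝ 𝔤 p) := by
    rw [toMatrix_ad_transpose hτ hb, hp, map_neg, map_neg, neg_neg]
  have hE : NormedSpace.exp (LinearMap.toMatrixAlgEquiv b (LieAlgebra.ad ℝ 𝔤 p)) *ᵥ b.equivFun x =
      b.equivFun ((expAd p : Module.End ℝ 𝔤) x) := by
    rw [← toMatrix_expAd, toMatrix_mulVec]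
  have h := (mulVec_eq_zero_of_exp hD (v := b.equivFun x) (by
    rw [hE, hcrit _ hw, hcrit _ hx])).2
  rw [hE] at h
  exact b.equivFun.injective h

end Conjugacy

end GradedLie

theorem proposition5 {𝔤 : Type*} [LieRing 𝔤] [LieAlgebra ℝ 𝔤] [FiniteDimensional ℝ 𝔤]
    [LieAlgebra.IsSemisimple ℝ 𝔤]
    (𝒢 : ZMod 2 → Submodule ℝ 𝔤) [GradedLieAlgebra 𝒢]
    (τ : 𝔤 ≃ₗ⁅ℝ⁆ 𝔤) (hτ : GradedLie.IsCartanInvolution τ) (hτ𝒢 : GradedLie.IsRCompatible 𝒢 τ)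
    (𝔥 : Submodule ℝ 𝔤) (h𝔥 : GradedLie.IsStandardCartanSubspace 𝒢 τ 𝔥)
    (h h' : 𝔤) (hh : h ∈ 𝔥) (hh' : h' ∈ 𝔥)
    (hconj : GradedLie.AdConj (GradedLie.zeroPart 𝒢) h h') :
    GradedLie.AdConj (GradedLie.zeroPart 𝒢 ⊓ GradedLie.fixedPart τ) h h' := by
  obtain ⟨θ, hθ, hθ0, hτθ'⟩ := GradedLie.exists_grading_involution 𝒢
  have hτθ := hτθ' τ hτ𝒢
  obtain ⟨b, hb⟩ := GradedLie.exists_basis_dotProduct (GradedLie.cartanForm τ)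
    (GradedLie.cartanForm_symm hτ) hτ.posDef
  obtain ⟨g, hg, hgh⟩ := hconj
  obtain ⟨hgθ, k, hk, hgk⟩ := GradedLie.orthFactor_mem_adGroup hτ hb hθ hτθ
    (𝔰 := GradedLie.zeroPart 𝒢) hθ0 hg
  obtain ⟨p, k', -, hp, -, horth, rfl⟩ := GradedLie.exists_polar hτ hb hθ hτθ hgθ
  have hD : (LinearMap.toMatrixAlgEquiv b (LieAlgebra.ad ℝ 𝔤 p)).transpose =
      LinearMap.toMatrixAlgEquiv b (LieAlgebra.ad ℝ 𝔤 p) := by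
    rw [GradedLie.toMatrix_ad_transpose hτ hb, hp, map_neg, map_neg, neg_neg]
  -- Uniqueness of the orthogonal factor identifies the factor from the polar decomposition with the
  -- one known to lie in `Ad_{K₀}`.
  have hkk : k' = k := by
    apply Units.ext
    apply (LinearMap.toMatrixAlgEquiv b).injective
    rw [← hgk, Units.val_mul, map_mul, GradedLie.toMatrix_expAd,
      GradedLie.orthFactor_mul_exp horth hD]
  subst hkk
  have hkτ := GradedLie.mem_commutingAutGroup_of_mem_adGroup hτ.involutive hk
  have hkτi := (GradedLie.commutingAutGroup τ).inv_mem hkτ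
  have hw : (GradedLie.expAd p : Module.End ℝ 𝔤) h =
      ((k'⁻¹ : LinearMap.GeneralLinearGroup ℝ 𝔤) : Module.End ℝ 𝔤) h' := by
    rw [← hgh, ← Module.End.mul_apply, ← Units.val_mul, inv_mul_cancel_left]
  -- The second bracket vanishes because `k'⁻¹` commutes with `τ` and carries `[h', τ h'] = 0` to
  -- the corresponding relation for `k'⁻¹ h'`.
  have hfix := GradedLie.expAd_apply_eq_self hτ hb hp (h𝔥.1.prop.2.2 h hh _ (h𝔥.2 h hh)) (by
    rw [hw, ← hkτi.2, ← hkτi.1, h𝔥.1.prop.2.2 h' hh' _ (h𝔥.2 h' hh'), map_zero])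
  refine ⟨k', hk, ?_⟩
  rw [← hgh, Units.val_mul, Module.End.mul_apply, hfix]
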